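/- For $A>2$ and a set $B\subset\{1,2,3,\dots\}$ of ``bad'' generations, the pruned Cantor set $E_{A,B}\subset\partial\mathbb D$ is defined as follows. Generation $0$ is the single arc $\{e^{it}:0\le t\le 1\}$. For $n\ge 1$, if $n\notin B$, each arc of generation $n-1$ (of length $A^{-(n-1)}$) is replaced by its two extreme closed subarcs of length $A^{-n}$, one at each end; if $n\in B$, only the left one of these two subarcs (the one at the end with the smaller argument) is kept. Then $E_{A,B}$ is the intersection over $n$ of the unions of the arcs of generation $n$. The complementary arcs of a closed set $E\subset\partial\mathbb D$ are the connected components $J$ of $\partial\mathbb D\setminus E$; $|J|$ denotes the arc length of $J$ and $a(J),b(J)$ its endpoints. For a finite positive measure $\mu$ on $\partial\mathbb D$, let $$S_\mu(z)=\exp\Bigl(-\int_{\partial\mathbb D}\frac{\zeta+z}{\zeta-z}\,d\mu(\zeta)\Bigr),\qquad |z|<1,$$ and let $H^p$ be the space of holomorphic functions $f$ on the unit disk with $\sup_{0<r<1}\int_0^{2\pi}|f(re^{i\theta})|^p\,d\theta<\infty$. **Lemma.** Let $0<p<1/2$ and $A=2^{(1-p)/(1-2p)}$. There exists a set $B$ of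 bad generations such that the pruned Cantor set $E=E_{A,B}$ is a closed set of zero length whose complementary arcs $\{J\}$ satisfy $$\sum_J |J|^{1-\frac{p}{1-p}}<\infty,$$ and the atomic measure $$\mu=\sum_J |J|^{\frac{1-2p}{1-p}}\,(\delta_{a(J)}+\delta_{b(J)})$$ is finite and supported on $E$, yet $S_\mu'\notin H^p$. -/

import Mathlib

open MeasureTheory Set
open scoped ENNReal NNReal

noncomputable section

/-- The unit circle carries its Borel `σ`-algebra. -/
instance circleMeasurableSpace : MeasurableSpace Circle := borel Circle

instance circleBorelSpace : BorelSpace Circle := ⟨rfl⟩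

/-- The left endpoints of the intervals of generation `n` of the Cantor construction in `[0, 1]` with
ratio `1 / A`, pruned at the generations in `bad`. Generation `0` is the single interval `[0, 1]`; the
intervals of generation `n` have length `A⁻¹ ^ n`. If generation `n + 1` is not in `bad`, then every
interval of generation `n` is replaced by its two extreme subintervals of length `A⁻¹ ^ (n + 1)`;
if it is in `bad`, only the left one of these two is kept. -/
def cantorLeftEndpoints (A : ℝ) (bad : Set ℕ) : ℕ → Set ℝ
  | 0 => {0}
  | n + 1 =>
      cantorLeftEndpoints A bad n ∪
        {y | n + 1 ∉ bad ∧ ∃ x ∈ cantorLeftEndpoints A bad n, y = x + A⁻¹ ^ n - A⁻¹ ^ (n + 1)}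

/-- The union of the intervals of generation `n`. -/
def cantorGeneration (A : ℝ) (bad : Set ℕ) (n : ℕ) : Set ℝ :=
  ⋃ x ∈ cantorLeftEndpoints A bad n, Icc x (x + A⁻¹ ^ n)

/-- The pruned Cantor set on the unit circle: the intersection of all generations, transported to
the circle by `t ↦ e ^ (i t)` (which preserves length). -/
def prunedCantorSet (A : ℝ) (bad : Set ℕ) : Set Circle :=
  Circle.exp '' ⋂ n, cantorGeneration A bad n

/-- Arc length measure on the unit circle (total mass `2 π`). -/
def arcLengthMeasure : Measure Circle :=
  (volume.restrict (Ioc 0 (2 * Real.pi))).map Circle.exp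

/-- A complementary arc `{e ^ (i t) : a < t < b}` of a set `E` of the unit circle: an open arc that
misses `E` and whose two endpoints `e ^ (i a)`, `e ^ (i b)` lie in `E` (they coincide if `E` is one
point). The normalization `0 ≤ a < 2 π` makes every arc occur exactly once. -/
@[ext]
structure ComplementaryArc (E : Set Circle) where
  a : ℝ
  b : ℝ
  a_nonneg : 0 ≤ a
  a_lt_two_pi : a < 2 * Real.pi
  a_lt_b : a < b
  b_le : b ≤ a + 2 * Real.pi
  left_mem : Circle.exp a ∈ E
  right_mem : Circle.exp b ∈ E
  disjoint : ∀ t ∈ Ioo a b, Circle.exp t ∉ E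

/-- The length `|J|` of a complementary arc. -/
def ComplementaryArc.length {E : Set Circle} (J : ComplementaryArc E) : ℝ := J.b - J.a

/-- The measure `∑_J |J| ^ s (δ_{a(J)} + δ_{b(J)})` over the complementary arcs `J` of `E`, where
`a(J)` and `b(J)` are the endpoints of `J`. -/
def endpointMeasure (E : Set Circle) (s : ℝ) : Measure Circle :=
  Measure.sum fun J : ComplementaryArc E =>
    ENNReal.ofReal (J.length ^ s) •
      (Measure.dirac (Circle.exp J.a) + Measure.dirac (Circle.exp J.b))

/-- The singular inner function `S_μ(z) = exp (- ∫ (ζ + z) / (ζ - z) dμ(ζ))`, for `|z| < 1`. -/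
def singularInner (μ : Measure Circle) (z : ℂ) : ℂ :=
  Complex.exp (-∫ ζ : Circle, ((ζ : ℂ) + z) / ((ζ : ℂ) - z) ∂μ)

/-- `f` belongs to the Hardy space `H^p` of the unit disk: it is holomorphic there and
the integrals of `|f| ^ p` over the circles `|z| = r`, `0 < r < 1`, are bounded. -/
def MemHardy (p : ℝ) (f : ℂ → ℂ) : Prop :=
  DifferentiableOn ℂ f (Metric.ball 0 1) ∧
    ∃ C : ℝ≥0, ∀ r ∈ Ioo (0 : ℝ) 1,
      ∫⁻ θ in Ioc 0 (2 * Real.pi), ‖f (r * Circle.exp θ)‖ₑ ^ p ≤ C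

end

/-!
Off the support of `μ` the function `S_μ` continues analytically across the circle, with modulus one
there and `|S_μ'(ζ)| = 2 ∫ |ξ - ζ|⁻² dμ(ξ)`; hence `S_μ' ∈ H^p` would force this function to be in
`L^p` of the circle, by Fatou's lemma.

Write `s = (1 - 2p) / (1 - p)`, so that `A⁻ˢ = 1 / 2` and `s` is also the exponent
`1 - p / (1 - p)`. Each gap opened when passing to generation `n + 1` has length comparable to
`A⁻ⁿ`, so its endpoints carry mass comparable to `2⁻ⁿ`. An interval of generation `n` followed by
`l` good generations has `2ᵏ` new gaps of generation `n + k` for every `k < l`; each of these levels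
contributes mass comparable to `2⁻ⁿ`, so the interval has mass at least `c l 2⁻ⁿ`, all at distance
at most `A⁻ⁿ` from its own gap, where therefore `|S_μ'| ≥ c l 2⁻ⁿ A²ⁿ`. As `s p - 2 p + 1 = s`, the
gaps of generation `n` contribute at least `c lᵖ wₙ` to `∫ |S_μ'|ᵖ`, where `wₙ` is `2⁻ⁿ` times the
number of intervals. A run of `2 l` good generations at weight `w` thus contributes `c w l^(1 + p)`,
whereas `∑ |J|ˢ` is controlled by `∑ wₙ`, in which the run counts only for `2 l w`.

Since a bad generation halves the weight, runs of lengths about `ρʲ` with `2 < ρ^(1 + p)` and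
`ρ < 2` make `∑ wₙ` finite and `w l^(1 + p)` unbounded.
-/

open Filter Topology

section Boundary

lemma hasDerivAt_herglotzKernel {ξ z : ℂ} (hz : ξ - z ≠ 0) :
    HasDerivAt (fun w => (ξ + w) / (ξ - w)) (2 * ξ / (ξ - z) ^ 2) z := by
  refine (((hasDerivAt_id z).const_add ξ).div ((hasDerivAt_id z).const_sub ξ) hz).congr_deriv ?_
  simp only [id]
  ring

lemma re_herglotzKernel_eq_zero (ξ ζ : Circle) : (((ξ : ℂ) + ζ) / (ξ - ζ)).re = 0 := by
  have hξ : (ξ : ℂ).re * (ξ : ℂ).re + (ξ : ℂ).im * (ξ : ℂ).im = 1 := by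
    simpa [Complex.normSq_apply] using Circle.normSq_coe ξ
  have hζ : (ζ : ℂ).re * (ζ : ℂ).re + (ζ : ℂ).im * (ζ : ℂ).im = 1 := by
    simpa [Complex.normSq_apply] using Circle.normSq_coe ζ
  rw [Complex.div_re, ← add_div, div_eq_zero_iff]
  left
  simp only [Complex.add_re, Complex.sub_re, Complex.add_im, Complex.sub_im]
  linear_combination hξ - hζ

/-- At `ξ = ζ` both sides are `0`, by the convention `x / 0 = 0`. -/
lemma two_mul_div_sub_sq_eq (ξ ζ : Circle) :
    2 * (ξ : ℂ) / (ξ - ζ) ^ 2 = -2 * (ζ : ℂ)⁻¹ * ((‖(ξ : ℂ) - ζ‖ ^ 2)⁻¹ : ℝ) := by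
  have hξ : (ξ : ℂ) ≠ 0 := Circle.coe_ne_zero ξ
  have hζ : (ζ : ℂ) ≠ 0 := Circle.coe_ne_zero ζ
  have hnorm : ((‖(ξ : ℂ) - ζ‖ ^ 2 : ℝ) : ℂ) = -((ξ : ℂ) - ζ) ^ 2 / (ξ * ζ) := by
    rw [← Complex.normSq_eq_norm_sq, Complex.normSq_eq_conj_mul_self, map_sub,
      ← Circle.coe_inv_eq_conj, ← Circle.coe_inv_eq_conj, Circle.coe_inv, Circle.coe_inv]
    field_simp
    ring
  rw [Complex.ofReal_inv, hnorm]
  field_simp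

variable {μ : Measure Circle}

lemma isClosed_coe_image_support (μ : Measure Circle) :
    IsClosed (((↑) : Circle → ℂ) '' μ.support) :=
  ((Measure.isClosed_support (μ := μ)).isCompact.image (by fun_prop)).isClosed

lemma exists_pos_ae_le_norm_sub {z : ℂ} (hz : z ∉ ((↑) : Circle → ℂ) '' μ.support) :
    ∃ δ > 0, ∀ᵐ ξ : Circle ∂μ, δ ≤ ‖(ξ : ℂ) - z‖ := by
  obtain ⟨δ, hδ, hball⟩ :=
    Metric.isOpen_iff.1 (isClosed_coe_image_support μ).isOpen_compl z hz
  refine ⟨δ, hδ, ?_⟩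
  filter_upwards [Measure.support_mem_ae (μ := μ)] with ξ hξ
  by_contra! hlt
  exact hball (mem_ball_iff_norm.2 hlt) (mem_image_of_mem _ hξ)

lemma coe_notMem_image_support {ζ : Circle} (hζ : ζ ∉ μ.support) :
    (ζ : ℂ) ∉ ((↑) : Circle → ℂ) '' μ.support :=
  fun h => hζ ((Circle.coe_injective.mem_set_image).1 h)

variable [IsFiniteMeasure μ]

lemma integrable_inv_norm_sub_pow {z : ℂ} (hz : z ∉ ((↑) : Circle → ℂ) '' μ.support) (k : ℕ) :
    Integrable (fun ξ : Circle => (‖(ξ : ℂ) - z‖ ^ k)⁻¹) μ := by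
  obtain ⟨δ, hδ, hae⟩ := exists_pos_ae_le_norm_sub hz
  refine .of_bound (Measurable.aestronglyMeasurable (by fun_prop)) (δ ^ k)⁻¹ ?_
  filter_upwards [hae] with ξ hξ
  rw [Real.norm_of_nonneg (by positivity)]
  gcongr

lemma integrable_herglotzKernel {z : ℂ} (hz : z ∉ ((↑) : Circle → ℂ) '' μ.support) :
    Integrable (fun ξ : Circle => ((ξ : ℂ) + z) / (ξ - z)) μ := by
  refine ((integrable_inv_norm_sub_pow hz 1).const_mul (1 + ‖z‖)).mono'
    (Measurable.aestronglyMeasurable (by fun_prop)) (.of_forall fun ξ => ?_)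
  rw [norm_div, pow_one, div_eq_mul_inv]
  gcongr
  simpa only [Circle.norm_coe] using norm_add_le (ξ : ℂ) z

lemma hasDerivAt_integral_herglotzKernel {z : ℂ} (hz : z ∉ ((↑) : Circle → ℂ) '' μ.support) :
    HasDerivAt (fun w => ∫ ξ : Circle, ((ξ : ℂ) + w) / (ξ - w) ∂μ)
      (∫ ξ : Circle, 2 * (ξ : ℂ) / (ξ - z) ^ 2 ∂μ) z := by
  obtain ⟨δ, hδ, hae⟩ := exists_pos_ae_le_norm_sub hz
  have hfar : ∀ᵐ ξ : Circle ∂μ, ∀ w ∈ Metric.ball z (δ / 2), δ / 2 ≤ ‖(ξ : ℂ) - w‖ := by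
    filter_upwards [hae] with ξ hξ w hw
    have := norm_sub_le_norm_sub_add_norm_sub (ξ : ℂ) w z
    linarith [mem_ball_iff_norm.1 hw]
  refine (hasDerivAt_integral_of_dominated_loc_of_deriv_le (bound := fun _ => 2 / (δ / 2) ^ 2)
    (F' := fun w (ξ : Circle) => 2 * (ξ : ℂ) / (ξ - w) ^ 2)
    (Metric.ball_mem_nhds z (half_pos hδ))
    (.of_forall fun w => Measurable.aestronglyMeasurable (by fun_prop))
    (integrable_herglotzKernel hz) (Measurable.aestronglyMeasurable (by fun_prop)) ?_
    (integrable_const _) ?_).2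
  · filter_upwards [hfar] with ξ hξ w hw
    have := hξ w hw
    rw [norm_div, norm_mul, norm_pow, Circle.norm_coe, mul_one, Complex.norm_ofNat]
    gcongr
  · filter_upwards [hfar] with ξ hξ w hw
    exact hasDerivAt_herglotzKernel (norm_pos_iff.1 ((half_pos hδ).trans_le (hξ w hw)))

lemma hasDerivAt_singularInner {z : ℂ} (hz : z ∉ ((↑) : Circle → ℂ) '' μ.support) :
    HasDerivAt (singularInner μ)
      (singularInner μ z * -∫ ξ : Circle, 2 * (ξ : ℂ) / (ξ - z) ^ 2 ∂μ) z :=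
  (hasDerivAt_integral_herglotzKernel hz).fun_neg.cexp

lemma continuousAt_deriv_singularInner {z : ℂ} (hz : z ∉ ((↑) : Circle → ℂ) '' μ.support) :
    ContinuousAt (deriv (singularInner μ)) z := by
  have hdiff : DifferentiableOn ℂ (singularInner μ) (((↑) : Circle → ℂ) '' μ.support)ᶜ :=
    fun w hw => (hasDerivAt_singularInner hw).differentiableAt.differentiableWithinAt
  have hopen := (isClosed_coe_image_support μ).isOpen_compl
  exact (hdiff.analyticAt (hopen.mem_nhds hz)).deriv.continuousAt

lemma norm_singularInner_eq_one {ζ : Circle} (hζ : ζ ∉ μ.support) : ‖singularInner μ ζ‖ = 1 := by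
  have h := integral_re (integrable_herglotzKernel (coe_notMem_image_support hζ))
  simp only [RCLike.re_eq_complex_re, re_herglotzKernel_eq_zero, integral_zero] at h
  rw [singularInner, Complex.norm_exp, Complex.neg_re, ← h, neg_zero, Real.exp_zero]

lemma norm_deriv_singularInner {ζ : Circle} (hζ : ζ ∉ μ.support) :
    ‖deriv (singularInner μ) ζ‖ = 2 * ∫ ξ : Circle, (‖(ξ : ℂ) - ζ‖ ^ 2)⁻¹ ∂μ := by
  have hnonneg : 0 ≤ ∫ ξ : Circle, (‖(ξ : ℂ) - ζ‖ ^ 2)⁻¹ ∂μ :=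
    integral_nonneg fun _ => by positivity
  simp only [(hasDerivAt_singularInner (coe_notMem_image_support hζ)).deriv,
    two_mul_div_sub_sq_eq, integral_const_mul, integral_complex_ofReal, norm_mul, norm_neg,
    norm_inv, norm_singularInner_eq_one hζ, Circle.norm_coe, Complex.norm_real,
    Complex.norm_ofNat, Real.norm_of_nonneg hnonneg, inv_one, mul_one, one_mul]

lemma mass_div_sq_le_norm_deriv_singularInner {ζ : Circle} (hζ : ζ ∉ μ.support) {T : Set Circle}
    (hT : MeasurableSet T) {d : ℝ} (hTd : ∀ ξ ∈ T, ‖(ξ : ℂ) - ζ‖ ≤ d) :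
    2 * (μ.real T / d ^ 2) ≤ ‖deriv (singularInner μ) ζ‖ := by
  have hz := coe_notMem_image_support hζ
  have hint := integrable_inv_norm_sub_pow hz 2
  obtain ⟨δ, hδ, hae⟩ := exists_pos_ae_le_norm_sub hz
  rw [norm_deriv_singularInner hζ]
  gcongr
  calc μ.real T / d ^ 2 = ∫ _ in T, (d ^ 2)⁻¹ ∂μ := by
        rw [setIntegral_const, smul_eq_mul, div_eq_mul_inv]
    _ ≤ ∫ ξ in T, (‖(ξ : ℂ) - ζ‖ ^ 2)⁻¹ ∂μ := by
        refine integral_mono_ae (integrable_const _) hint.integrableOn ?_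
        filter_upwards [ae_restrict_mem hT, ae_restrict_of_ae hae] with ξ hξT hξ
        have hpos : 0 < ‖(ξ : ℂ) - ζ‖ := hδ.trans_le hξ
        have := hTd ξ hξT
        change (d ^ 2)⁻¹ ≤ (‖(ξ : ℂ) - ζ‖ ^ 2)⁻¹
        gcongr
    _ ≤ _ := setIntegral_le_integral hint (.of_forall fun _ => by positivity)

end Boundary

lemma MemHardy.exists_setLIntegral_le {p : ℝ} {f : ℂ → ℂ} (hf : MemHardy p f) :
    ∃ C : ℝ≥0, ∀ s ⊆ Ioc (0 : ℝ) (2 * Real.pi), MeasurableSet s →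
      (∀ θ ∈ s, ContinuousAt f (Circle.exp θ)) →
        ∫⁻ θ in s, ‖f (Circle.exp θ)‖ₑ ^ p ≤ C := by
  obtain ⟨hdiff, C, hC⟩ := hf
  refine ⟨C, fun s hs hsm hcont => ?_⟩
  obtain ⟨r, -, hr, hr1⟩ := exists_seq_strictMono_tendsto' (zero_lt_one' ℝ)
  have hmeas (n : ℕ) : Measurable fun θ : ℝ => ‖f (r n * Circle.exp θ)‖ₑ ^ p := by
    have hball (θ : ℝ) : (r n : ℂ) * Circle.exp θ ∈ Metric.ball 0 1 := by
      simp [abs_of_pos (hr n).1, (hr n).2]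
    have hcomp : Continuous fun θ : ℝ => f (r n * Circle.exp θ) :=
      hdiff.continuousOn.comp_continuous (by fun_prop) hball
    exact hcomp.measurable.enorm.pow_const p
  have hlim {θ : ℝ} (hθ : θ ∈ s) : Tendsto (fun n => ‖f (r n * Circle.exp θ)‖ₑ ^ p) atTop
      (𝓝 (‖f (Circle.exp θ)‖ₑ ^ p)) := by
    have hradial : Tendsto (fun n => (r n : ℂ) * Circle.exp θ) atTop (𝓝 (Circle.exp θ)) := by
      simpa using ((Complex.continuous_ofReal.tendsto 1).comp hr1).mul_const (Circle.exp θ : ℂ)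
    exact (ENNReal.continuous_rpow_const.tendsto _).comp
      ((hcont θ hθ).tendsto.comp hradial).enorm
  calc ∫⁻ θ in s, ‖f (Circle.exp θ)‖ₑ ^ p
      = ∫⁻ θ in s, liminf (fun n => ‖f (r n * Circle.exp θ)‖ₑ ^ p) atTop :=
        setLIntegral_congr_fun hsm fun θ hθ => (hlim hθ).liminf_eq.symm
    _ ≤ ∫⁻ θ in Ioc 0 (2 * Real.pi), liminf (fun n => ‖f (r n * Circle.exp θ)‖ₑ ^ p) atTop :=
        lintegral_mono_set hs
    _ ≤ liminf (fun n => ∫⁻ θ in Ioc 0 (2 * Real.pi), ‖f (r n * Circle.exp θ)‖ₑ ^ p) atTop :=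
        lintegral_liminf_le hmeas
    _ ≤ C := liminf_le_of_frequently_le' (.of_forall fun n => hC (r n) (hr n))

/-- The Cantor set on the line whose image on the circle is `prunedCantorSet A bad`. -/
def cantorLimit (A : ℝ) (bad : Set ℕ) : Set ℝ :=
  ⋂ n, cantorGeneration A bad n

/-- The left endpoints that appear in passing from generation `n` to generation `n + 1`. Every gap
opened at that step has exactly one of them as its right endpoint. -/
def newLeftEndpoints (A : ℝ) (bad : Set ℕ) (n : ℕ) : Set ℝ :=
  cantorLeftEndpoints A bad (n + 1) \ cantorLeftEndpoints A bad n

/-- The part of generation `n` that is removed in passing to generation `n + 1`. -/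
def cantorGaps (A : ℝ) (bad : Set ℕ) (n : ℕ) : Set ℝ :=
  cantorGeneration A bad n \ cantorGeneration A bad (n + 1)

/-- The number of intervals of generation `n`, divided by the number `2 ^ n` that there would be
without pruning. -/
noncomputable def cantorWeight (A : ℝ) (bad : Set ℕ) (n : ℕ) : ℝ :=
  (cantorLeftEndpoints A bad n).ncard * (1 / 2) ^ n

section CantorGenerations

variable {A : ℝ} {bad : Set ℕ} {n m : ℕ} {x y t : ℝ}

lemma two_mul_inv_lt_one (hA : 2 < A) : 2 * A⁻¹ < 1 := by
  rw [← div_eq_mul_inv]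
  exact (div_lt_one (by positivity)).2 hA

lemma two_mul_inv_pow_succ_lt (hA : 2 < A) (n : ℕ) : 2 * A⁻¹ ^ (n + 1) < A⁻¹ ^ n :=
  calc 2 * A⁻¹ ^ (n + 1) = 2 * A⁻¹ * A⁻¹ ^ n := by ring
    _ < A⁻¹ ^ n := mul_lt_of_lt_one_left (by positivity) (two_mul_inv_lt_one hA)

lemma cantorLeftEndpoints_mono : Monotone (cantorLeftEndpoints A bad) :=
  monotone_nat_of_le_succ fun _ => subset_union_left

lemma zero_mem_cantorLeftEndpoints (n : ℕ) : 0 ∈ cantorLeftEndpoints A bad n :=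
  cantorLeftEndpoints_mono n.zero_le rfl

lemma cantorLeftEndpoints_succ_of_mem (hb : n + 1 ∈ bad) :
    cantorLeftEndpoints A bad (n + 1) = cantorLeftEndpoints A bad n := by
  simp [cantorLeftEndpoints, hb]

lemma exists_parent (hy : y ∈ cantorLeftEndpoints A bad (n + 1)) :
    ∃ x ∈ cantorLeftEndpoints A bad n, y = x ∨ y = x + A⁻¹ ^ n - A⁻¹ ^ (n + 1) := by
  rcases hy with hy | ⟨-, x, hx, rfl⟩
  · exact ⟨y, hy, .inl rfl⟩
  · exact ⟨x, hx, .inr rfl⟩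

lemma finite_cantorLeftEndpoints (n : ℕ) : (cantorLeftEndpoints A bad n).Finite := by
  induction n with
  | zero => exact finite_singleton 0
  | succ n ih =>
    refine (ih.union (ih.image fun x => x + A⁻¹ ^ n - A⁻¹ ^ (n + 1))).subset ?_
    exact union_subset_union_right _ fun y ⟨_, x, hx, hyx⟩ => ⟨x, hx, hyx.symm⟩

lemma exists_ancestor (hA : 2 < A) (hnm : n ≤ m) (hy : y ∈ cantorLeftEndpoints A bad m) :
    ∃ x ∈ cantorLeftEndpoints A bad n, Icc y (y + A⁻¹ ^ m) ⊆ Icc x (x + A⁻¹ ^ n) := by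
  induction m, hnm using Nat.le_induction generalizing y with
  | base => exact ⟨y, hy, Subset.rfl⟩
  | succ m _ ih =>
    obtain ⟨z, hz, hyz⟩ := exists_parent hy
    obtain ⟨x, hx, hzx⟩ := ih hz
    have hratio := two_mul_inv_pow_succ_lt hA m
    have hpos : 0 < A⁻¹ ^ (m + 1) := by positivity
    exact ⟨x, hx, (Icc_subset_Icc (by grind) (by grind)).trans hzx⟩

lemma cantorLeftEndpoints_separated (hA : 2 < A) (hx : x ∈ cantorLeftEndpoints A bad n)
    (hy : y ∈ cantorLeftEndpoints A bad n) (hxy : x < y) : x + A⁻¹ ^ n < y := by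
  induction n generalizing x y with
  | zero => exact absurd (hx.trans hy.symm) hxy.ne
  | succ n ih =>
    have hratio := two_mul_inv_pow_succ_lt hA n
    have _ : 0 < A⁻¹ ^ (n + 1) := by positivity
    obtain ⟨x', hx', hxx'⟩ := exists_parent hx
    obtain ⟨y', hy', hyy'⟩ := exists_parent hy
    rcases lt_trichotomy x' y' with h | rfl | h
    · grind [ih hx' hy' h]
    · grind
    · grind [ih hy' hx' h]

lemma cantorLeftEndpoints_eq_of_mem_Icc (hA : 2 < A) (hx : x ∈ cantorLeftEndpoints A bad n)
    (hy : y ∈ cantorLeftEndpoints A bad n) (htx : t ∈ Icc x (x + A⁻¹ ^ n))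
    (hty : t ∈ Icc y (y + A⁻¹ ^ n)) : x = y := by
  rcases lt_trichotomy x y with h | h | h
  · exact absurd (cantorLeftEndpoints_separated hA hx hy h) (hty.1.trans htx.2).not_gt
  · exact h
  · exact absurd (cantorLeftEndpoints_separated hA hy hx h) (htx.1.trans hty.2).not_gt

lemma left_mem_Icc_cantor (hA : 2 < A) (n : ℕ) (x : ℝ) : x ∈ Icc x (x + A⁻¹ ^ n) :=
  left_mem_Icc.2 (le_add_of_nonneg_right (by positivity))

lemma mem_Icc_iff_left_mem_Icc (hA : 2 < A) (hnm : n ≤ m) (hx : x ∈ cantorLeftEndpoints A bad n)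
    (hy : y ∈ cantorLeftEndpoints A bad m) (ht : t ∈ Icc y (y + A⁻¹ ^ m)) :
    t ∈ Icc x (x + A⁻¹ ^ n) ↔ y ∈ Icc x (x + A⁻¹ ^ n) := by
  obtain ⟨z, hz, hsub⟩ := exists_ancestor hA hnm hy
  have hyz := hsub (left_mem_Icc_cantor hA m y)
  constructor <;> intro h
  · exact cantorLeftEndpoints_eq_of_mem_Icc hA hx hz h (hsub ht) ▸ hyz
  · exact cantorLeftEndpoints_eq_of_mem_Icc hA hx hz h hyz ▸ hsub ht

lemma mem_cantorGeneration :
    t ∈ cantorGeneration A bad n ↔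
      ∃ x ∈ cantorLeftEndpoints A bad n, t ∈ Icc x (x + A⁻¹ ^ n) := by
  simp only [cantorGeneration, mem_iUnion, exists_prop]

lemma cantorGeneration_antitone (hA : 2 < A) : Antitone (cantorGeneration A bad) := by
  intro n m hnm t ht
  obtain ⟨y, hy, hty⟩ := mem_cantorGeneration.1 ht
  obtain ⟨x, hx, hsub⟩ := exists_ancestor hA hnm hy
  exact mem_cantorGeneration.2 ⟨x, hx, hsub hty⟩

lemma isCompact_cantorGeneration (n : ℕ) : IsCompact (cantorGeneration A bad n) :=
  (finite_cantorLeftEndpoints n).isCompact_biUnion fun _ _ => isCompact_Icc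

lemma isCompact_cantorLimit : IsCompact (cantorLimit A bad) :=
  (isCompact_cantorGeneration 0).of_isClosed_subset
    (isClosed_iInter fun n => (isCompact_cantorGeneration n).isClosed) (iInter_subset _ 0)

lemma cantorGeneration_subset_Icc (hA : 2 < A) (n : ℕ) : cantorGeneration A bad n ⊆ Icc 0 1 :=
  (cantorGeneration_antitone hA n.zero_le).trans (by simp [cantorGeneration, cantorLeftEndpoints])

lemma cantorLeftEndpoints_subset_cantorGeneration (hA : 2 < A) (n m : ℕ) :
    cantorLeftEndpoints A bad n ⊆ cantorGeneration A bad m := fun x hx =>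
  cantorGeneration_antitone hA (le_max_right n m) <| mem_cantorGeneration.2
    ⟨x, cantorLeftEndpoints_mono (le_max_left n m) hx, left_mem_Icc_cantor hA _ x⟩

lemma cantorLeftEndpoints_subset_cantorLimit (hA : 2 < A) (n : ℕ) :
    cantorLeftEndpoints A bad n ⊆ cantorLimit A bad :=
  subset_iInter (cantorLeftEndpoints_subset_cantorGeneration hA n)

lemma notMem_cantorGeneration_succ (hA : 2 < A) (hx : x ∈ cantorLeftEndpoints A bad n)
    (ht : t ∈ Ioo (x + A⁻¹ ^ (n + 1)) (x + A⁻¹ ^ n - A⁻¹ ^ (n + 1))) :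
    t ∉ cantorGeneration A bad (n + 1) := by
  intro hmem
  have _ := two_mul_inv_pow_succ_lt hA n
  have hpos : 0 < A⁻¹ ^ (n + 1) := by positivity
  obtain ⟨y, hy, hty⟩ := mem_cantorGeneration.1 hmem
  obtain ⟨z, hz, hyz⟩ := exists_parent hy
  obtain rfl : x = z := cantorLeftEndpoints_eq_of_mem_Icc hA (t := t) hx hz (by grind) (by grind)
  grind

lemma newLeftEndpoints_eq_empty (hb : n + 1 ∈ bad) : newLeftEndpoints A bad n = ∅ := by
  rw [newLeftEndpoints, cantorLeftEndpoints_succ_of_mem hb, sdiff_self]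

lemma newLeftEndpoints_eq_image (hA : 2 < A) (hb : n + 1 ∉ bad) :
    newLeftEndpoints A bad n =
      (fun x => x + (A⁻¹ ^ n - A⁻¹ ^ (n + 1))) '' cantorLeftEndpoints A bad n := by
  have hratio := two_mul_inv_pow_succ_lt hA n
  have hpos : 0 < A⁻¹ ^ (n + 1) := by positivity
  ext y
  constructor
  · rintro ⟨hy | ⟨-, x, hx, rfl⟩, hy'⟩
    · exact absurd hy hy'
    · exact ⟨x, hx, (add_sub_assoc ..).symm⟩
  · rintro ⟨x, hx, rfl⟩
    refine ⟨.inr ⟨hb, x, hx, (add_sub_assoc ..).symm⟩, fun hy => ?_⟩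
    linarith [cantorLeftEndpoints_separated hA hx hy (by linarith)]

lemma pairwise_disjoint_newLeftEndpoints :
    Pairwise (Function.onFun Disjoint (newLeftEndpoints A bad)) := by
  refine (pairwise_disjoint_on _).2 fun k l hkl => Set.disjoint_left.2 fun y hk hl => hl.2 ?_
  exact cantorLeftEndpoints_mono hkl hk.1

lemma ncard_cantorLeftEndpoints_succ_inter (n : ℕ) (s : Set ℝ) :
    (cantorLeftEndpoints A bad (n + 1) ∩ s).ncard =
      (cantorLeftEndpoints A bad n ∩ s).ncard + (newLeftEndpoints A bad n ∩ s).ncard := by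
  have hunion : cantorLeftEndpoints A bad (n + 1) =
      cantorLeftEndpoints A bad n ∪ newLeftEndpoints A bad n :=
    (union_sdiff_cancel (cantorLeftEndpoints_mono n.le_succ)).symm
  have hdisj : Disjoint (cantorLeftEndpoints A bad n) (newLeftEndpoints A bad n) :=
    disjoint_sdiff_right
  rw [hunion, union_inter_distrib_right,
    ncard_union_eq (hdisj.mono inter_subset_left inter_subset_left)
      ((finite_cantorLeftEndpoints n).inter_of_left s)
      ((finite_cantorLeftEndpoints (n + 1)).sdiff.inter_of_left s)]

lemma ncard_newLeftEndpoints (hA : 2 < A) (hb : n + 1 ∉ bad) :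
    (newLeftEndpoints A bad n).ncard = (cantorLeftEndpoints A bad n).ncard := by
  rw [newLeftEndpoints_eq_image hA hb, ncard_image_of_injective _ (add_left_injective _)]

lemma ncard_newLeftEndpoints_le (hA : 2 < A) (n : ℕ) :
    (newLeftEndpoints A bad n).ncard ≤ (cantorLeftEndpoints A bad n).ncard := by
  by_cases hb : n + 1 ∈ bad
  · simp [newLeftEndpoints_eq_empty hb]
  · exact (ncard_newLeftEndpoints hA hb).le

lemma ncard_cantorLeftEndpoints_succ (hA : 2 < A) (hb : n + 1 ∉ bad) :
    (cantorLeftEndpoints A bad (n + 1)).ncard = 2 * (cantorLeftEndpoints A bad n).ncard := by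
  have h := ncard_cantorLeftEndpoints_succ_inter (A := A) (bad := bad) n univ
  rwa [inter_univ, inter_univ, inter_univ, ncard_newLeftEndpoints hA hb, ← two_mul] at h

lemma ncard_newLeftEndpoints_inter_Icc (hA : 2 < A) (hnm : n ≤ m) (hb : m + 1 ∉ bad)
    (hx : x ∈ cantorLeftEndpoints A bad n) :
    (newLeftEndpoints A bad m ∩ Icc x (x + A⁻¹ ^ n)).ncard =
      (cantorLeftEndpoints A bad m ∩ Icc x (x + A⁻¹ ^ n)).ncard := by
  have hratio := two_mul_inv_pow_succ_lt hA m
  have hpos : 0 < A⁻¹ ^ (m + 1) := by positivity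
  rw [newLeftEndpoints_eq_image hA hb, ← image_inter_preimage,
    ncard_image_of_injective _ (add_left_injective _)]
  congr 1
  ext y
  refine and_congr_right fun hy => mem_Icc_iff_left_mem_Icc hA hnm hx hy ⟨?_, ?_⟩ <;> linarith

lemma ncard_cantorLeftEndpoints_inter_Icc (hA : 2 < A) (hnm : n ≤ m)
    (hgood : Disjoint (Ioc n m) bad) (hx : x ∈ cantorLeftEndpoints A bad n) :
    (cantorLeftEndpoints A bad m ∩ Icc x (x + A⁻¹ ^ n)).ncard = 2 ^ (m - n) := by
  induction m, hnm using Nat.le_induction with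
  | base =>
    have hsingle : cantorLeftEndpoints A bad n ∩ Icc x (x + A⁻¹ ^ n) = {x} :=
      eq_singleton_iff_unique_mem.2 ⟨⟨hx, left_mem_Icc_cantor hA n x⟩, fun y hy =>
        cantorLeftEndpoints_eq_of_mem_Icc hA hy.1 hx (left_mem_Icc_cantor hA n y) hy.2⟩
    rw [hsingle, ncard_singleton, Nat.sub_self, pow_zero]
  | succ m hnm ih =>
    have hb : m + 1 ∉ bad := Set.disjoint_left.1 hgood ⟨by lia, le_rfl⟩
    rw [ncard_cantorLeftEndpoints_succ_inter, ncard_newLeftEndpoints_inter_Icc hA hnm hb hx,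
      ih (hgood.mono_left (Ioc_subset_Ioc_right m.le_succ)), ← two_mul, ← pow_succ',
      Nat.sub_add_comm hnm]

end CantorGenerations

section CantorWeight

variable {A : ℝ} {bad : Set ℕ} {n m : ℕ}

lemma cantorWeight_nonneg (A : ℝ) (bad : Set ℕ) (n : ℕ) : 0 ≤ cantorWeight A bad n := by
  unfold cantorWeight
  positivity

lemma cantorWeight_zero : cantorWeight A bad 0 = 1 := by
  simp [cantorWeight, cantorLeftEndpoints]

lemma cantorWeight_succ_of_notMem (hA : 2 < A) (hb : n + 1 ∉ bad) :
    cantorWeight A bad (n + 1) = cantorWeight A bad n := by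
  rw [cantorWeight, cantorWeight, ncard_cantorLeftEndpoints_succ hA hb]
  push_cast
  ring

lemma cantorWeight_succ_of_mem (hb : n + 1 ∈ bad) :
    cantorWeight A bad (n + 1) = cantorWeight A bad n / 2 := by
  rw [cantorWeight, cantorWeight, cantorLeftEndpoints_succ_of_mem hb]
  ring

lemma cantorWeight_eq_of_disjoint (hA : 2 < A) (hnm : n ≤ m) (hgood : Disjoint (Ioc n m) bad) :
    cantorWeight A bad m = cantorWeight A bad n := by
  induction m, hnm using Nat.le_induction with
  | base => rfl
  | succ m hnm ih =>
    rw [cantorWeight_succ_of_notMem hA (Set.disjoint_left.1 hgood ⟨by lia, le_rfl⟩),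
      ih (hgood.mono_left (Ioc_subset_Ioc_right m.le_succ))]

lemma cantorWeight_antitone (hA : 2 < A) : Antitone (cantorWeight A bad) := by
  refine antitone_nat_of_succ_le fun n => ?_
  by_cases hb : n + 1 ∈ bad
  · linarith [cantorWeight_succ_of_mem (A := A) hb, cantorWeight_nonneg A bad n]
  · exact (cantorWeight_succ_of_notMem hA hb).le

end CantorWeight

section CantorVolume

variable {A : ℝ} {bad : Set ℕ} {n : ℕ}

lemma volume_cantorGeneration (hA : 2 < A) (n : ℕ) :
    volume (cantorGeneration A bad n) =
      ENNReal.ofReal ((cantorLeftEndpoints A bad n).ncard * A⁻¹ ^ n) := by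
  have hfin := finite_cantorLeftEndpoints (A := A) (bad := bad) n
  have hdisj : (cantorLeftEndpoints A bad n).PairwiseDisjoint fun x => Icc x (x + A⁻¹ ^ n) :=
    fun x hx y hy hne => Set.disjoint_left.2 fun t htx hty =>
      hne (cantorLeftEndpoints_eq_of_mem_Icc hA hx hy htx hty)
  rw [cantorGeneration, ← hfin.coe_toFinset] at *
  simp only [Finset.mem_coe]
  rw [measure_biUnion_finset hdisj fun _ _ => measurableSet_Icc]
  simp only [Real.volume_Icc, add_sub_cancel_left, Finset.sum_const, ncard_coe_finset,
    nsmul_eq_mul]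
  rw [ENNReal.ofReal_mul (by positivity), ENNReal.ofReal_natCast]

lemma volume_cantorGeneration_le (hA : 2 < A) (n : ℕ) :
    volume (cantorGeneration A bad n) ≤ ENNReal.ofReal ((2 * A⁻¹) ^ n) := by
  have hweight : cantorWeight A bad n ≤ 1 :=
    (cantorWeight_antitone hA n.zero_le).trans cantorWeight_zero.le
  rw [volume_cantorGeneration hA]
  gcongr
  calc ((cantorLeftEndpoints A bad n).ncard : ℝ) * A⁻¹ ^ n
      = cantorWeight A bad n * (2 * A⁻¹) ^ n := by
        rw [cantorWeight, mul_assoc, ← mul_pow]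
        ring_nf
    _ ≤ (2 * A⁻¹) ^ n := mul_le_of_le_one_left (by positivity) hweight

lemma volume_cantorLimit (hA : 2 < A) : volume (cantorLimit A bad) = 0 := by
  have htendsto : Tendsto (fun n => ENNReal.ofReal ((2 * A⁻¹) ^ n)) atTop (𝓝 0) := by
    simpa using ENNReal.tendsto_ofReal
      (tendsto_pow_atTop_nhds_zero_of_lt_one (by positivity) (two_mul_inv_lt_one hA))
  exact le_antisymm (ge_of_tendsto' htendsto fun n =>
    (measure_mono (iInter_subset _ n)).trans (volume_cantorGeneration_le hA n)) zero_le

lemma volume_cantorGaps (hA : 2 < A) (hb : n + 1 ∉ bad) :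
    volume (cantorGaps A bad n) =
      ENNReal.ofReal ((1 - 2 * A⁻¹) * ((cantorLeftEndpoints A bad n).ncard * A⁻¹ ^ n)) := by
  rw [cantorGaps, measure_sdiff (cantorGeneration_antitone hA (Nat.le_add_right n 1))
      (isCompact_cantorGeneration _).measurableSet.nullMeasurableSet
      (isCompact_cantorGeneration _).measure_lt_top.ne,
    volume_cantorGeneration hA, volume_cantorGeneration hA, ← ENNReal.ofReal_sub _ (by positivity),
    ncard_cantorLeftEndpoints_succ hA hb]
  congr 1
  push_cast
  ring

end CantorVolume

section PrunedCantorSet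

variable {A : ℝ} {bad : Set ℕ} {n : ℕ} {s t b : ℝ}

lemma one_lt_two_pi : 1 < 2 * Real.pi := by linarith [Real.pi_gt_three]

lemma cantorLimit_subset_Ico (hA : 2 < A) : cantorLimit A bad ⊆ Ico 0 (2 * Real.pi) :=
  (iInter_subset _ 0).trans <| (cantorGeneration_subset_Icc hA 0).trans <|
    Icc_subset_Ico_right one_lt_two_pi

lemma exp_mem_prunedCantorSet_iff (hA : 2 < A) (ht : t ∈ Ico 0 (2 * Real.pi)) :
    Circle.exp t ∈ prunedCantorSet A bad ↔ t ∈ cantorLimit A bad :=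
  (Circle.exp_injOn_Ico (sub_zero _).le).mem_image_iff (cantorLimit_subset_Ico hA) ht

lemma exp_mem_prunedCantorSet (ht : t ∈ cantorLimit A bad) :
    Circle.exp t ∈ prunedCantorSet A bad :=
  mem_image_of_mem _ ht

lemma isClosed_prunedCantorSet : IsClosed (prunedCantorSet A bad) :=
  (isCompact_cantorLimit.image Circle.exp.continuous).isClosed

lemma arcLengthMeasure_prunedCantorSet (hA : 2 < A) :
    arcLengthMeasure (prunedCantorSet A bad) = 0 := by
  have hexp : Measurable (Circle.exp : ℝ → Circle) := Circle.exp.continuous.measurable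
  have hE : MeasurableSet (prunedCantorSet A bad) := isClosed_prunedCantorSet.measurableSet
  rw [arcLengthMeasure, Measure.map_apply hexp hE, ← restrict_Ico_eq_restrict_Ioc,
    Measure.restrict_apply (hexp hE)]
  exact measure_mono_null (fun t ht => (exp_mem_prunedCantorSet_iff hA ht.2).1 ht.1)
    (volume_cantorLimit hA)

lemma ComplementaryArc.length_pos {E : Set Circle} (J : ComplementaryArc E) : 0 < J.length :=
  sub_pos.2 J.a_lt_b

lemma ComplementaryArc.a_mem_cantorLimit (hA : 2 < A)
    (J : ComplementaryArc (prunedCantorSet A bad)) : J.a ∈ cantorLimit A bad :=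
  (exp_mem_prunedCantorSet_iff hA ⟨J.a_nonneg, J.a_lt_two_pi⟩).1 J.left_mem

lemma ComplementaryArc.notMem_cantorLimit (J : ComplementaryArc (prunedCantorSet A bad))
    (ht : t ∈ Ioo J.a J.b) : t ∉ cantorLimit A bad := fun h =>
  J.disjoint t ht (exp_mem_prunedCantorSet h)

lemma ComplementaryArc.b_le_two_pi (hA : 2 < A) (J : ComplementaryArc (prunedCantorSet A bad)) :
    J.b ≤ 2 * Real.pi := by
  by_contra! hlt
  refine J.disjoint _ ⟨J.a_lt_two_pi, hlt⟩ ?_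
  rw [Circle.exp_two_pi, ← Circle.exp_zero]
  exact exp_mem_prunedCantorSet
    (cantorLeftEndpoints_subset_cantorLimit hA 0 (zero_mem_cantorLeftEndpoints 0))

lemma ComplementaryArc.b_injective (hA : 2 < A) :
    Function.Injective (ComplementaryArc.b : ComplementaryArc (prunedCantorSet A bad) → ℝ) := by
  intro J J' hb
  refine ComplementaryArc.ext ?_ hb
  rcases lt_trichotomy J.a J'.a with h | h | h
  · exact absurd (J'.a_mem_cantorLimit hA) (J.notMem_cantorLimit ⟨h, hb ▸ J'.a_lt_b⟩)
  · exact h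
  · exact absurd (J.a_mem_cantorLimit hA) (J'.notMem_cantorLimit ⟨h, hb ▸ J.a_lt_b⟩)

/-- Once the intervals of generation `n` are shorter than the arc, the one containing `J.b` must
start at `J.b`. -/
lemma ComplementaryArc.exists_b_mem_cantorLeftEndpoints (hA : 2 < A)
    (J : ComplementaryArc (prunedCantorSet A bad)) (hb : J.b ≠ 2 * Real.pi) :
    ∃ n, J.b ∈ cantorLeftEndpoints A bad n := by
  have hbK : J.b ∈ cantorLimit A bad := (exp_mem_prunedCantorSet_iff hA
    ⟨J.a_nonneg.trans J.a_lt_b.le, (J.b_le_two_pi hA).lt_of_ne hb⟩).1 J.right_mem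
  obtain ⟨n, hn⟩ := exists_pow_lt_of_lt_one (sub_pos.2 J.a_lt_b)
    (inv_lt_one_of_one_lt₀ (one_lt_two.trans hA))
  obtain ⟨x, hx, hxb, hbx⟩ := mem_cantorGeneration.1 (mem_iInter.1 hbK n)
  obtain hlt | rfl := hxb.lt_or_eq
  · exact absurd (cantorLeftEndpoints_subset_cantorLimit hA n hx)
      (J.notMem_cantorLimit ⟨by linarith, hlt⟩)
  · exact ⟨n, hx⟩

lemma ComplementaryArc.exists_b_mem_newLeftEndpoints (hA : 2 < A)
    (J : ComplementaryArc (prunedCantorSet A bad)) (hb : J.b ≠ 2 * Real.pi) :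
    ∃ n, J.b ∈ newLeftEndpoints A bad n := by
  classical
  have hex := J.exists_b_mem_cantorLeftEndpoints hA hb
  obtain ⟨n, hn⟩ : ∃ n, Nat.find hex = n + 1 := by
    refine Nat.exists_eq_succ_of_ne_zero fun hzero => ?_
    have hb0 : J.b = 0 := by simpa [hzero, cantorLeftEndpoints] using Nat.find_spec hex
    exact (J.a_nonneg.trans_lt J.a_lt_b).ne' hb0
  exact ⟨n, hn ▸ Nat.find_spec hex, Nat.find_min hex (by lia)⟩

lemma ComplementaryArc.length_le (hA : 2 < A) (J : ComplementaryArc (prunedCantorSet A bad))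
    (hb : J.b ∈ newLeftEndpoints A bad n) : J.length ≤ A⁻¹ ^ n := by
  obtain ⟨x, hx, h | h⟩ := exists_parent hb.1
  · exact absurd (h ▸ hx) hb.2
  have hratio := two_mul_inv_pow_succ_lt hA n
  have hpos : 0 < A⁻¹ ^ (n + 1) := by positivity
  have hxa : x ≤ J.a := by
    by_contra! hlt
    exact J.notMem_cantorLimit ⟨hlt, by linarith⟩ (cantorLeftEndpoints_subset_cantorLimit hA n hx)
  rw [ComplementaryArc.length]
  linarith

lemma exists_complementaryArc (hA : 2 < A) (hb : b ∈ newLeftEndpoints A bad n) :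
    ∃ J : ComplementaryArc (prunedCantorSet A bad), J.b = b ∧
      (1 - 2 * A⁻¹) * A⁻¹ ^ n ≤ J.length := by
  obtain ⟨x, hx, rfl | rfl⟩ := exists_parent hb.1
  · exact absurd hx hb.2
  set b := x + A⁻¹ ^ n - A⁻¹ ^ (n + 1) with hbx
  have hratio := two_mul_inv_pow_succ_lt hA n
  have hpos : 0 < A⁻¹ ^ (n + 1) := by positivity
  have hxK : x ∈ cantorLimit A bad := cantorLeftEndpoints_subset_cantorLimit hA _ hx
  have hbK : b ∈ cantorLimit A bad := cantorLeftEndpoints_subset_cantorLimit hA _ hb.1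
  have hne : (cantorLimit A bad ∩ Iic (x + A⁻¹ ^ (n + 1))).Nonempty :=
    ⟨x, hxK, le_add_of_nonneg_right hpos.le⟩
  obtain ⟨a, ⟨haK, hax⟩, hmax⟩ :=
    (isCompact_cantorLimit.inter_right isClosed_Iic).exists_isGreatest hne
  obtain ⟨ha0, ha2⟩ := cantorLimit_subset_Ico hA haK
  obtain ⟨-, hb2⟩ := cantorLimit_subset_Ico hA hbK
  have hgap : ∀ t ∈ Ioo a b, Circle.exp t ∉ prunedCantorSet A bad := by
    intro t ht hmem
    rw [exp_mem_prunedCantorSet_iff hA ⟨ha0.trans ht.1.le, ht.2.trans hb2⟩] at hmem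
    have htx : x + A⁻¹ ^ (n + 1) < t := by
      by_contra! hle
      exact (hmax ⟨hmem, hle⟩).not_gt ht.1
    exact notMem_cantorGeneration_succ hA hx ⟨htx, ht.2⟩ (mem_iInter.1 hmem (n + 1))
  have hax' : a ≤ x + A⁻¹ ^ (n + 1) := hax
  have hlength : (1 - 2 * A⁻¹) * A⁻¹ ^ n ≤ b - a := by
    rw [pow_succ] at hax' hbx
    linarith
  exact ⟨⟨a, b, ha0, ha2, by linarith, by linarith, exp_mem_prunedCantorSet haK,
    exp_mem_prunedCantorSet hbK, hgap⟩, rfl, hlength⟩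

lemma inv_pow_rpow (hA : 0 < A) (hs : A⁻¹ ^ s = 1 / 2) (n : ℕ) :
    (A⁻¹ ^ n) ^ s = (1 / 2) ^ n := by
  have hA' : 0 ≤ A⁻¹ := inv_nonneg.2 hA.le
  rw [← Real.rpow_natCast, ← Real.rpow_mul hA', mul_comm, Real.rpow_mul hA', hs,
    Real.rpow_natCast]

lemma summable_sigma_newLeftEndpoints (hA : 2 < A) (hsum : Summable (cantorWeight A bad)) :
    Summable fun i : Σ n, newLeftEndpoints A bad n => (1 / 2 : ℝ) ^ i.1 := by
  have hfin (n : ℕ) : Finite (newLeftEndpoints A bad n) :=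
    (finite_cantorLeftEndpoints (n + 1)).sdiff.to_subtype
  refine (summable_sigma_of_nonneg fun i => by positivity).2
    ⟨fun n => .of_finite, hsum.of_nonneg_of_le (fun n => tsum_nonneg fun _ => by positivity)
      fun n => ?_⟩
  simp only [tsum_const, nsmul_eq_mul, Nat.card_coe_set_eq, cantorWeight]
  exact mul_le_mul_of_nonneg_right (mod_cast ncard_newLeftEndpoints_le hA n) (by positivity)

lemma summable_length_rpow (hA : 2 < A) (hs0 : 0 < s) (hs : A⁻¹ ^ s = 1 / 2)
    (hsum : Summable (cantorWeight A bad)) :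
    Summable fun J : ComplementaryArc (prunedCantorSet A bad) => J.length ^ s := by
  let last : Set (ComplementaryArc (prunedCantorSet A bad)) := {J | J.b = 2 * Real.pi}
  have hlast : last.Subsingleton := fun J hJ J' hJ' =>
    ComplementaryArc.b_injective hA (hJ.trans hJ'.symm)
  have : Finite last := hlast.finite
  refine (summable_subtype_and_compl (s := last)).1 ⟨.of_finite, ?_⟩
  choose level hlevel using fun J : (lastᶜ : Set _) => J.1.exists_b_mem_newLeftEndpoints hA J.2
  have hinj : Function.Injective fun J : (lastᶜ : Set _) =>
      (⟨level J, ⟨J.1.b, hlevel J⟩⟩ : Σ n, newLeftEndpoints A bad n) := fun J J' h =>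
    Subtype.ext (ComplementaryArc.b_injective hA (congrArg (fun i => (i.2 : ℝ)) h))
  refine ((summable_sigma_newLeftEndpoints hA hsum).comp_injective hinj).of_nonneg_of_le
    (fun J => Real.rpow_nonneg J.1.length_pos.le s) fun J => ?_
  rw [Function.comp_apply, ← inv_pow_rpow (by positivity) hs]
  exact Real.rpow_le_rpow J.1.length_pos.le (J.1.length_le hA (hlevel J)) hs0.le

end PrunedCantorSet

section EndpointMeasure

variable {E : Set Circle} {s : ℝ}

lemma isFiniteMeasure_endpointMeasure
    (h : Summable fun J : ComplementaryArc E => J.length ^ s) :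
    IsFiniteMeasure (endpointMeasure E s) := by
  refine ⟨?_⟩
  rw [endpointMeasure, Measure.sum_apply _ MeasurableSet.univ]
  simp only [Measure.smul_apply, Measure.add_apply, measure_univ, smul_eq_mul]
  rw [ENNReal.tsum_mul_right]
  exact ENNReal.mul_lt_top h.tsum_ofReal_lt_top (by simp)

lemma endpointMeasure_compl (hE : IsClosed E) : endpointMeasure E s Eᶜ = 0 := by
  rw [endpointMeasure, Measure.sum_apply _ hE.measurableSet.compl, ENNReal.tsum_eq_zero]
  intro J
  simp [Measure.dirac_apply' _ hE.measurableSet.compl, J.left_mem, J.right_mem]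

lemma support_endpointMeasure_subset (hE : IsClosed E) : (endpointMeasure E s).support ⊆ E :=
  Measure.support_subset_of_isClosed hE (mem_ae_iff.2 (endpointMeasure_compl hE))

lemma ofReal_length_rpow_le_endpointMeasure_singleton (J : ComplementaryArc E) :
    ENNReal.ofReal (J.length ^ s) ≤ endpointMeasure E s {Circle.exp J.b} := by
  refine le_trans ?_ (Measure.le_sum _ J _)
  rw [Measure.smul_apply, Measure.add_apply, smul_eq_mul,
    Measure.dirac_apply_of_mem (mem_singleton _)]
  exact le_mul_of_one_le_right zero_le le_add_self

end EndpointMeasure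

section CantorMass

lemma ncard_mul_le_measure {α : Type*} [MeasurableSpace α] [MeasurableSingletonClass α]
    (μ : Measure α) {S : Set α} (hS : S.Finite) {w : ℝ≥0∞} (hw : ∀ x ∈ S, w ≤ μ {x}) :
    S.ncard * w ≤ μ S := by
  rw [← hS.coe_toFinset, ncard_coe_finset, ← sum_measure_singleton, ← nsmul_eq_mul]
  exact Finset.card_nsmul_le_sum _ _ _ fun x hx => hw x (hS.mem_toFinset.1 hx)

variable {A : ℝ} {bad : Set ℕ} {s x b : ℝ} {n m : ℕ}

lemma newLeftEndpoints_subset_Ico (hA : 2 < A) (n : ℕ) :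
    newLeftEndpoints A bad n ⊆ Ico 0 (2 * Real.pi) :=
  sdiff_subset.trans <| (cantorLeftEndpoints_subset_cantorLimit hA (n + 1)).trans <|
    cantorLimit_subset_Ico hA

lemma ofReal_le_endpointMeasure_singleton (hA : 2 < A) (hs0 : 0 < s) (hs : A⁻¹ ^ s = 1 / 2)
    (hb : b ∈ newLeftEndpoints A bad n) :
    ENNReal.ofReal ((1 - 2 * A⁻¹) ^ s * (1 / 2) ^ n) ≤
      endpointMeasure (prunedCantorSet A bad) s {Circle.exp b} := by
  obtain ⟨J, rfl, hJ⟩ := exists_complementaryArc hA hb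
  have hratio : 0 < 1 - 2 * A⁻¹ := sub_pos.2 (two_mul_inv_lt_one hA)
  refine le_trans (ENNReal.ofReal_le_ofReal ?_) (ofReal_length_rpow_le_endpointMeasure_singleton J)
  rw [← inv_pow_rpow (by positivity) hs, ← Real.mul_rpow hratio.le (by positivity)]
  exact Real.rpow_le_rpow (by positivity) hJ hs0.le

/-- There are `2 ^ (k - n)` new endpoints, each of mass at least a multiple of `2 ^ (-k)`: the bound
does not depend on `k`. -/
lemma ofReal_le_endpointMeasure_newLeftEndpoints {k : ℕ} (hA : 2 < A) (hs0 : 0 < s)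
    (hs : A⁻¹ ^ s = 1 / 2) (hk : k ∈ Ico n m) (hgood : Disjoint (Ioc n m) bad)
    (hx : x ∈ cantorLeftEndpoints A bad n) :
    ENNReal.ofReal ((1 - 2 * A⁻¹) ^ s * (1 / 2) ^ n) ≤ endpointMeasure (prunedCantorSet A bad) s
      (Circle.exp '' (newLeftEndpoints A bad k ∩ Icc x (x + A⁻¹ ^ n))) := by
  obtain ⟨hnk, hkm⟩ := hk
  set S := newLeftEndpoints A bad k ∩ Icc x (x + A⁻¹ ^ n) with hS
  have hfin : S.Finite := (finite_cantorLeftEndpoints (k + 1)).sdiff.inter_of_left _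
  have hinj : InjOn Circle.exp S := (Circle.exp_injOn_Ico (sub_zero _).le).mono
    (inter_subset_left.trans (newLeftEndpoints_subset_Ico hA k))
  have hcard : S.ncard = 2 ^ (k - n) := by
    rw [hS, ncard_newLeftEndpoints_inter_Icc hA hnk
      (Set.disjoint_left.1 hgood ⟨by lia, by lia⟩) hx]
    exact ncard_cantorLeftEndpoints_inter_Icc hA hnk
      (hgood.mono_left (Ioc_subset_Ioc_right hkm.le)) hx
  refine le_trans (le_of_eq ?_) (ncard_mul_le_measure _ (hfin.image _) ?_
    (w := ENNReal.ofReal ((1 - 2 * A⁻¹) ^ s * (1 / 2) ^ k)))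
  · rw [hinj.ncard_image, hcard, ← ENNReal.ofReal_natCast, ← ENNReal.ofReal_mul (by positivity)]
    obtain ⟨d, rfl⟩ := Nat.exists_eq_add_of_le hnk
    have hpow : (2 : ℝ) ^ d * (1 / 2) ^ d = 1 := by rw [← mul_pow]; norm_num
    rw [Nat.add_sub_cancel_left, pow_add]
    push_cast
    congr 1
    linear_combination (-(1 - 2 * A⁻¹) ^ s * (1 / 2) ^ n) * hpow
  · rintro _ ⟨t, ht, rfl⟩
    exact ofReal_le_endpointMeasure_singleton hA hs0 hs ht.1

lemma le_endpointMeasure_exp_image_Icc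
    {l : ℕ} [IsFiniteMeasure (endpointMeasure (prunedCantorSet A bad) s)] (hA : 2 < A) (hs0 : 0 < s)
    (hs : A⁻¹ ^ s = 1 / 2) (hgood : Disjoint (Ioc n (n + l)) bad)
    (hx : x ∈ cantorLeftEndpoints A bad n) :
    l * ((1 - 2 * A⁻¹) ^ s * (1 / 2) ^ n) ≤
      (endpointMeasure (prunedCantorSet A bad) s).real (Circle.exp '' Icc x (x + A⁻¹ ^ n)) := by
  set μ := endpointMeasure (prunedCantorSet A bad) s
  let level (k : ℕ) : Set Circle :=
    Circle.exp '' (newLeftEndpoints A bad k ∩ Icc x (x + A⁻¹ ^ n))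
  have hmeas (k : ℕ) : MeasurableSet (level k) :=
    (((finite_cantorLeftEndpoints (k + 1)).sdiff.inter_of_left _).image _).measurableSet
  have hdisj : Pairwise (Function.onFun Disjoint level) := fun k j hkl =>
    ((pairwise_disjoint_newLeftEndpoints hkl).mono inter_subset_left inter_subset_left).image
      (Circle.exp_injOn_Ico (sub_zero _).le)
      (inter_subset_left.trans (newLeftEndpoints_subset_Ico hA k))
      (inter_subset_left.trans (newLeftEndpoints_subset_Ico hA j))
  rw [measureReal_def, ← ENNReal.ofReal_le_iff_le_toReal (measure_ne_top _ _)]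
  calc ENNReal.ofReal (l * ((1 - 2 * A⁻¹) ^ s * (1 / 2) ^ n))
      = ∑ _k ∈ Finset.Ico n (n + l), ENNReal.ofReal ((1 - 2 * A⁻¹) ^ s * (1 / 2) ^ n) := by
        rw [Finset.sum_const, Nat.card_Ico, Nat.add_sub_cancel_left,
          ENNReal.ofReal_mul (Nat.cast_nonneg _), ENNReal.ofReal_natCast, nsmul_eq_mul]
    _ ≤ ∑ k ∈ Finset.Ico n (n + l), μ (level k) := Finset.sum_le_sum fun k hk =>
        ofReal_le_endpointMeasure_newLeftEndpoints hA hs0 hs (Finset.mem_Ico.1 hk) hgood hx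
    _ = μ (⋃ k ∈ Finset.Ico n (n + l), level k) :=
        (measure_biUnion_finset (hdisj.set_pairwise _) fun k _ => hmeas k).symm
    _ ≤ μ (Circle.exp '' Icc x (x + A⁻¹ ^ n)) :=
        measure_mono (iUnion₂_subset fun k _ => image_mono inter_subset_right)

end CantorMass

section LowerBound

lemma norm_exp_sub_exp_le (t u : ℝ) : ‖(Circle.exp t : ℂ) - Circle.exp u‖ ≤ |t - u| := by
  have hfactor : (Circle.exp t : ℂ) - Circle.exp u =
      Circle.exp u * (Complex.exp (Complex.I * (t - u : ℝ)) - 1) := by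
    rw [mul_sub, Circle.coe_exp, Circle.coe_exp, ← Complex.exp_add, mul_one]
    congr 2
    push_cast
    ring
  rw [hfactor, norm_mul, Circle.norm_coe, one_mul]
  exact Real.norm_exp_I_mul_ofReal_sub_one_le

variable {A : ℝ} {bad : Set ℕ} {p s θ : ℝ} {n : ℕ}

lemma cantorGaps_subset_Ioc (hA : 2 < A) (n : ℕ) :
    cantorGaps A bad n ⊆ Ioc 0 (2 * Real.pi) := by
  rintro θ ⟨hθ, hθ'⟩
  obtain ⟨h0, h1⟩ := cantorGeneration_subset_Icc hA n hθ
  refine ⟨h0.lt_of_ne' ?_, h1.trans one_lt_two_pi.le⟩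
  rintro rfl
  exact hθ' (cantorLeftEndpoints_subset_cantorGeneration hA 0 (n + 1)
    (zero_mem_cantorLeftEndpoints 0))

lemma measurableSet_cantorGaps (n : ℕ) : MeasurableSet (cantorGaps A bad n) :=
  (isCompact_cantorGeneration n).measurableSet.diff
    (isCompact_cantorGeneration (n + 1)).measurableSet

lemma pairwise_disjoint_cantorGaps (hA : 2 < A) :
    Pairwise (Function.onFun Disjoint (cantorGaps A bad)) :=
  (pairwise_disjoint_on _).2 fun _ _ hlt => Set.disjoint_left.2 fun _ h h' =>
    h.2 (cantorGeneration_antitone hA hlt h'.1)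

lemma exp_notMem_prunedCantorSet (hA : 2 < A) (hθ : θ ∈ cantorGaps A bad n) :
    Circle.exp θ ∉ prunedCantorSet A bad := by
  obtain ⟨h0, h1⟩ := cantorGeneration_subset_Icc hA n hθ.1
  rw [exp_mem_prunedCantorSet_iff hA ⟨h0, h1.trans_lt one_lt_two_pi⟩]
  exact fun h => hθ.2 (mem_iInter.1 h (n + 1))

lemma le_norm_deriv_singularInner_exp {l : ℕ}
    [IsFiniteMeasure (endpointMeasure (prunedCantorSet A bad) s)] (hA : 2 < A) (hs0 : 0 < s)
    (hs : A⁻¹ ^ s = 1 / 2) (hgood : Disjoint (Ioc n (n + l)) bad)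
    (hθ : θ ∈ cantorGaps A bad n) :
    2 * l * (1 - 2 * A⁻¹) ^ s * (1 / 2) ^ n / (A⁻¹ ^ n) ^ 2 ≤
      ‖deriv (singularInner (endpointMeasure (prunedCantorSet A bad) s)) (Circle.exp θ)‖ := by
  obtain ⟨x, hx, hxθ⟩ := mem_cantorGeneration.1 hθ.1
  have hclose : ∀ ξ ∈ Circle.exp '' Icc x (x + A⁻¹ ^ n),
      ‖(ξ : ℂ) - Circle.exp θ‖ ≤ A⁻¹ ^ n := by
    rintro _ ⟨t, ht, rfl⟩
    exact (norm_exp_sub_exp_le t θ).trans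
      ((abs_sub_le_of_le_of_le ht.1 ht.2 hxθ.1 hxθ.2).trans_eq (add_sub_cancel_left _ _))
  have hmeas : MeasurableSet (Circle.exp '' Icc x (x + A⁻¹ ^ n)) :=
    (isCompact_Icc.image Circle.exp.continuous).measurableSet
  refine le_trans ?_ (mass_div_sq_le_norm_deriv_singularInner (fun h =>
    exp_notMem_prunedCantorSet hA hθ (support_endpointMeasure_subset isClosed_prunedCantorSet h))
    hmeas hclose)
  rw [mul_assoc 2, mul_assoc 2, mul_div_assoc 2, mul_assoc (l : ℝ)]
  gcongr
  exact le_endpointMeasure_exp_image_Icc hA hs0 hs hgood hx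

/-- The exponent `s` makes this scale-invariant: `s * p - 2 * p + 1 = s`. -/
lemma mul_half_pow_div_sq_rpow_mul_inv_pow {c : ℝ} (hA : 0 < A) (hps : s * (1 - p) = 1 - 2 * p)
    (hs : A⁻¹ ^ s = 1 / 2) (hc : 0 ≤ c) (n : ℕ) :
    (c * (1 / 2) ^ n / (A⁻¹ ^ n) ^ 2) ^ p * A⁻¹ ^ n = c ^ p * (1 / 2) ^ n := by
  have hQs := inv_pow_rpow hA hs n
  have hQ : 0 < A⁻¹ ^ n := by positivity
  set Q := A⁻¹ ^ n
  calc (c * (1 / 2) ^ n / Q ^ 2) ^ p * Q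
      = c ^ p * (Q ^ (s * p) / Q ^ (2 * p) * Q ^ (1 : ℝ)) := by
        rw [← hQs, Real.div_rpow (by positivity) (by positivity), Real.mul_rpow hc (by positivity),
          ← Real.rpow_mul hQ.le, ← Real.rpow_natCast Q 2, ← Real.rpow_mul hQ.le, Real.rpow_one]
        push_cast
        ring
    _ = c ^ p * Q ^ s := by
        rw [← Real.rpow_sub hQ, ← Real.rpow_add hQ]
        congr 2
        linarith
    _ = c ^ p * (1 / 2) ^ n := by rw [hQs]

lemma le_setLIntegral_deriv_singularInner {l : ℕ}
    [IsFiniteMeasure (endpointMeasure (prunedCantorSet A bad) s)] (hp : 0 ≤ p) (hA : 2 < A)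
    (hs0 : 0 < s) (hps : s * (1 - p) = 1 - 2 * p) (hs : A⁻¹ ^ s = 1 / 2) (hl : 0 < l)
    (hgood : Disjoint (Ioc n (n + l)) bad) :
    ENNReal.ofReal ((1 - 2 * A⁻¹) * (2 * l * (1 - 2 * A⁻¹) ^ s) ^ p * cantorWeight A bad n) ≤
      ∫⁻ θ in cantorGaps A bad n, ‖deriv (singularInner
        (endpointMeasure (prunedCantorSet A bad) s)) (Circle.exp θ)‖ₑ ^ p := by
  have hratio : 0 < 1 - 2 * A⁻¹ := sub_pos.2 (two_mul_inv_lt_one hA)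
  set v : ℝ := 2 * l * (1 - 2 * A⁻¹) ^ s * (1 / 2) ^ n / (A⁻¹ ^ n) ^ 2
  have hv : 0 ≤ v := by positivity
  have hscale : v ^ p * A⁻¹ ^ n = (2 * l * (1 - 2 * A⁻¹) ^ s) ^ p * (1 / 2) ^ n :=
    mul_half_pow_div_sq_rpow_mul_inv_pow (by positivity) hps hs (by positivity) n
  calc ENNReal.ofReal ((1 - 2 * A⁻¹) * (2 * l * (1 - 2 * A⁻¹) ^ s) ^ p * cantorWeight A bad n)
      = ENNReal.ofReal v ^ p * volume (cantorGaps A bad n) := by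
        rw [volume_cantorGaps hA (Set.disjoint_left.1 hgood ⟨n.lt_succ_self, by lia⟩),
          ENNReal.ofReal_rpow_of_nonneg hv hp, ← ENNReal.ofReal_mul (by positivity), cantorWeight]
        congr 1
        linear_combination -((1 - 2 * A⁻¹) * (cantorLeftEndpoints A bad n).ncard) * hscale
    _ = ∫⁻ _ in cantorGaps A bad n, ENNReal.ofReal v ^ p := (setLIntegral_const _ _).symm
    _ ≤ _ := by
        refine setLIntegral_mono' (measurableSet_cantorGaps n) fun θ hθ => ?_
        rw [← ofReal_norm]
        gcongr
        exact le_norm_deriv_singularInner_exp hA hs0 hs hgood hθ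

lemma mul_le_setLIntegral_deriv_singularInner {l : ℕ}
    [IsFiniteMeasure (endpointMeasure (prunedCantorSet A bad) s)] (hp : 0 ≤ p) (hA : 2 < A)
    (hs0 : 0 < s) (hps : s * (1 - p) = 1 - 2 * p) (hs : A⁻¹ ^ s = 1 / 2)
    (hgood : Disjoint (Ioc n (n + 2 * l)) bad) :
    l * ENNReal.ofReal ((1 - 2 * A⁻¹) * (2 * l * (1 - 2 * A⁻¹) ^ s) ^ p * cantorWeight A bad n) ≤
      ∫⁻ θ in ⋃ k ∈ Finset.Ico n (n + l), cantorGaps A bad k, ‖deriv (singularInner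
        (endpointMeasure (prunedCantorSet A bad) s)) (Circle.exp θ)‖ₑ ^ p := by
  rw [lintegral_biUnion_finset ((pairwise_disjoint_cantorGaps hA).set_pairwise _)
    fun k _ => measurableSet_cantorGaps k]
  calc l * ENNReal.ofReal _
      = ∑ _k ∈ Finset.Ico n (n + l), ENNReal.ofReal _ := by
        rw [Finset.sum_const, Nat.card_Ico, Nat.add_sub_cancel_left, nsmul_eq_mul]
    _ ≤ _ := by
        refine Finset.sum_le_sum fun k hk => ?_
        obtain ⟨hnk, hkl⟩ := Finset.mem_Ico.1 hk
        rw [← cantorWeight_eq_of_disjoint hA hnk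
          (hgood.mono_left (Ioc_subset_Ioc_right (by lia)))]
        exact le_setLIntegral_deriv_singularInner hp hA hs0 hps hs (by lia)
          (hgood.mono_left (Ioc_subset_Ioc hnk (by lia)))

lemma MemHardy.exists_cantorWeight_mul_rpow_le (hp : 0 < p) (hA : 2 < A) (hs0 : 0 < s)
    (hps : s * (1 - p) = 1 - 2 * p) (hs : A⁻¹ ^ s = 1 / 2)
    [IsFiniteMeasure (endpointMeasure (prunedCantorSet A bad) s)]
    (hf : MemHardy p (deriv (singularInner (endpointMeasure (prunedCantorSet A bad) s)))) :
    ∃ C : ℝ, ∀ n l : ℕ, Disjoint (Ioc n (n + 2 * l)) bad →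
      cantorWeight A bad n * (l : ℝ) ^ (1 + p) ≤ C := by
  obtain ⟨C, hC⟩ := hf.exists_setLIntegral_le
  have hratio : 0 < 1 - 2 * A⁻¹ := sub_pos.2 (two_mul_inv_lt_one hA)
  refine ⟨C / ((1 - 2 * A⁻¹) * (2 * (1 - 2 * A⁻¹) ^ s) ^ p), fun n l hgood => ?_⟩
  have hcont : ∀ θ ∈ ⋃ k ∈ Finset.Ico n (n + l), cantorGaps A bad k, ContinuousAt
      (deriv (singularInner (endpointMeasure (prunedCantorSet A bad) s))) (Circle.exp θ) := by
    intro θ hθ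
    obtain ⟨k, -, hk⟩ := mem_iUnion₂.1 hθ
    exact continuousAt_deriv_singularInner (coe_notMem_image_support fun h =>
      exp_notMem_prunedCantorSet hA hk (support_endpointMeasure_subset isClosed_prunedCantorSet h))
  have hbound := (mul_le_setLIntegral_deriv_singularInner hp.le hA hs0 hps hs hgood).trans <|
    hC _ (iUnion₂_subset fun k _ => cantorGaps_subset_Ioc hA k)
      (Finset.measurableSet_biUnion _ fun k _ => measurableSet_cantorGaps k) hcont
  rw [← ENNReal.ofReal_natCast, ← ENNReal.ofReal_mul (by positivity), ← ENNReal.ofReal_coe_nnreal,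
    ENNReal.ofReal_le_ofReal_iff C.coe_nonneg, mul_right_comm 2,
    Real.mul_rpow (by positivity) (by positivity)] at hbound
  rw [le_div_iff₀ (by positivity), Real.rpow_one_add' (by positivity) (by positivity)]
  linarith

end LowerBound

/-- The `j`-th bad generation if `0 < j`, and the initial generation `0` if `j = 0`. Between
`badTime ℓ j` and `badTime ℓ (j + 1)` there are `2 * ℓ j` good generations. -/
def badTime (ℓ : ℕ → ℕ) (j : ℕ) : ℕ :=
  ∑ i ∈ Finset.range j, (2 * ℓ i + 1)

/-- The set of bad generations that leaves runs of good generations of lengths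
`2 * ℓ 0, 2 * ℓ 1, …`. -/
def badGenerations (ℓ : ℕ → ℕ) : Set ℕ :=
  range fun j => badTime ℓ (j + 1)

section BadGenerations

variable {A p : ℝ} {ℓ : ℕ → ℕ}

lemma badTime_succ (ℓ : ℕ → ℕ) (j : ℕ) : badTime ℓ (j + 1) = badTime ℓ j + 2 * ℓ j + 1 :=
  Finset.sum_range_succ _ _

lemma strictMono_badTime (ℓ : ℕ → ℕ) : StrictMono (badTime ℓ) :=
  strictMono_nat_of_lt_succ fun j => by
    rw [badTime_succ]
    lia

lemma disjoint_Ioc_badTime (ℓ : ℕ → ℕ) (j : ℕ) :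
    Disjoint (Ioc (badTime ℓ j) (badTime ℓ j + 2 * ℓ j)) (badGenerations ℓ) := by
  refine Set.disjoint_left.2 ?_
  rintro _ ⟨hlo, hhi⟩ ⟨i, rfl⟩
  have hji : j < i + 1 := (strictMono_badTime ℓ).lt_iff_lt.1 hlo
  have hij : i + 1 < j + 1 := (strictMono_badTime ℓ).lt_iff_lt.1 <| by
    rw [badTime_succ ℓ j]
    exact Nat.lt_succ_of_le hhi
  lia

lemma cantorWeight_badTime (hA : 2 < A) (j : ℕ) :
    cantorWeight A (badGenerations ℓ) (badTime ℓ j) = (1 / 2) ^ j := by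
  induction j with
  | zero => exact cantorWeight_zero
  | succ j ih =>
    have hbad : badTime ℓ j + 2 * ℓ j + 1 ∈ badGenerations ℓ := ⟨j, badTime_succ ℓ j⟩
    rw [badTime_succ, cantorWeight_succ_of_mem hbad,
      cantorWeight_eq_of_disjoint hA (Nat.le_add_right _ _) (disjoint_Ioc_badTime ℓ j), ih]
    ring

lemma sum_cantorWeight_badTime_le (hA : 2 < A) (j : ℕ) :
    ∑ n ∈ Finset.range (badTime ℓ j), cantorWeight A (badGenerations ℓ) n ≤
      ∑ i ∈ Finset.range j, (2 * ℓ i + 1) * (1 / 2 : ℝ) ^ i := by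
  induction j with
  | zero => simp [badTime]
  | succ j ih =>
    rw [badTime_succ, add_assoc, Finset.sum_range_add, Finset.sum_range_succ _ j]
    refine add_le_add ih ?_
    calc ∑ k ∈ Finset.range (2 * ℓ j + 1), cantorWeight A (badGenerations ℓ) (badTime ℓ j + k)
        ≤ ∑ _k ∈ Finset.range (2 * ℓ j + 1), (1 / 2 : ℝ) ^ j :=
          Finset.sum_le_sum fun k _ => (cantorWeight_antitone hA (Nat.le_add_right _ k)).trans_eq
            (cantorWeight_badTime hA j)
      _ = (2 * ℓ j + 1) * (1 / 2 : ℝ) ^ j := by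
          rw [Finset.sum_const, Finset.card_range, nsmul_eq_mul]
          push_cast
          rfl

lemma summable_cantorWeight_badGenerations (hA : 2 < A)
    (hℓ : Summable fun j => (2 * ℓ j + 1) * (1 / 2 : ℝ) ^ j) :
    Summable (cantorWeight A (badGenerations ℓ)) := by
  refine summable_of_sum_range_le (c := ∑' i, (2 * ℓ i + 1) * (1 / 2 : ℝ) ^ i)
    (cantorWeight_nonneg A _) fun n => ?_
  calc ∑ k ∈ Finset.range n, cantorWeight A (badGenerations ℓ) k
      ≤ ∑ k ∈ Finset.range (badTime ℓ n), cantorWeight A (badGenerations ℓ) k :=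
        Finset.sum_le_sum_of_subset_of_nonneg
          (Finset.range_mono (strictMono_badTime ℓ).le_apply) fun k _ _ => cantorWeight_nonneg A _ k
    _ ≤ ∑ i ∈ Finset.range n, (2 * ℓ i + 1) * (1 / 2 : ℝ) ^ i := sum_cantorWeight_badTime_le hA n
    _ ≤ ∑' i, (2 * ℓ i + 1) * (1 / 2 : ℝ) ^ i := hℓ.sum_le_tsum _ fun i _ => by positivity

lemma summable_ceil_pow_mul_half_pow {ρ : ℝ} (hρ0 : 0 ≤ ρ) (hρ : ρ < 2) :
    Summable fun j : ℕ => (2 * ⌈ρ ^ j⌉₊ + 1) * (1 / 2 : ℝ) ^ j := by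
  have hmajorant : Summable fun j : ℕ => 2 * (ρ / 2) ^ j + 3 * (1 / 2 : ℝ) ^ j :=
    ((summable_geometric_of_lt_one (by positivity) (by linarith)).mul_left 2).add
      ((summable_geometric_of_lt_one (by positivity) (by norm_num)).mul_left 3)
  refine hmajorant.of_nonneg_of_le (fun j => by positivity) fun j => ?_
  calc (2 * ⌈ρ ^ j⌉₊ + 1) * (1 / 2 : ℝ) ^ j ≤ (2 * (ρ ^ j + 1) + 1) * (1 / 2 : ℝ) ^ j := by
        gcongr
        exact (Nat.ceil_lt_add_one (by positivity)).le
    _ = 2 * (ρ / 2) ^ j + 3 * (1 / 2 : ℝ) ^ j := by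
        rw [div_pow, div_pow, one_pow]
        ring

lemma exists_two_lt_rpow_one_add (hp : 0 < p) : ∃ ρ : ℝ, 0 < ρ ∧ ρ < 2 ∧ 2 < ρ ^ (1 + p) := by
  have hp1 : 0 < 1 + p := by linarith
  have hroot : (2 : ℝ) ^ (1 + p)⁻¹ < 2 :=
    Real.rpow_lt_self_of_one_lt one_lt_two (inv_lt_one_of_one_lt₀ (by linarith))
  obtain ⟨ρ, hlo, hhi⟩ := exists_between hroot
  have hρ0 : 0 < ρ := (by positivity : (0 : ℝ) < 2 ^ (1 + p)⁻¹).trans hlo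
  exact ⟨ρ, hρ0, hhi, (Real.rpow_inv_lt_iff_of_pos zero_le_two hρ0.le hp1).1 hlo⟩

lemma exists_bad_summable_cantorWeight (hA : 2 < A) (hp : 0 < p) :
    ∃ bad : Set ℕ, Summable (cantorWeight A bad) ∧ ∀ C : ℝ, ∃ n l : ℕ,
      Disjoint (Ioc n (n + 2 * l)) bad ∧ C < cantorWeight A bad n * (l : ℝ) ^ (1 + p) := by
  obtain ⟨ρ, hρ0, hρ2, hρp⟩ := exists_two_lt_rpow_one_add hp
  let ℓ (j : ℕ) : ℕ := ⌈ρ ^ j⌉₊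
  refine ⟨badGenerations ℓ,
    summable_cantorWeight_badGenerations hA (summable_ceil_pow_mul_half_pow hρ0.le hρ2),
    fun C => ?_⟩
  obtain ⟨j, hj⟩ := pow_unbounded_of_one_lt C ((one_lt_div two_pos).2 hρp)
  refine ⟨badTime ℓ j, ℓ j, disjoint_Ioc_badTime ℓ j, hj.trans_le ?_⟩
  calc (ρ ^ (1 + p) / 2) ^ j = (1 / 2) ^ j * (ρ ^ j) ^ (1 + p) := by
        rw [div_pow, ← Real.rpow_natCast_mul hρ0.le, ← Real.rpow_mul_natCast hρ0.le,
          mul_comm (1 + p), one_div_pow]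
        ring
    _ ≤ (1 / 2) ^ j * (ℓ j : ℝ) ^ (1 + p) := by
        gcongr
        exact Nat.le_ceil _
    _ = cantorWeight A (badGenerations ℓ) (badTime ℓ j) * (ℓ j : ℝ) ^ (1 + p) := by
        rw [cantorWeight_badTime hA]

end BadGenerations

section Exponents

variable {p : ℝ}

lemma two_lt_two_rpow_ratio (hp₀ : 0 < p) (hp₁ : p < 1 / 2) :
    (2 : ℝ) < 2 ^ ((1 - p) / (1 - 2 * p)) := by
  refine Real.self_lt_rpow_of_one_lt one_lt_two ((one_lt_div ?_).2 ?_) <;> linarith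

lemma inv_two_rpow_ratio_rpow (hp₁ : p < 1 / 2) :
    ((2 : ℝ) ^ ((1 - p) / (1 - 2 * p)))⁻¹ ^ ((1 - 2 * p) / (1 - p)) = 1 / 2 := by
  have h1 : 1 - 2 * p ≠ 0 := by linarith
  have h2 : 1 - p ≠ 0 := by linarith
  rw [Real.inv_rpow (by positivity), ← Real.rpow_mul zero_le_two, div_mul_div_cancel₀ h1,
    div_self h2, Real.rpow_one, one_div]

end Exponents

theorem mainTheorem12 (p : ℝ) (hp₀ : 0 < p) (hp₁ : p < 1 / 2) :
    ∃ (bad : Set ℕ) (E : Set Circle) (μ : Measure Circle),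
      E = prunedCantorSet (2 ^ ((1 - p) / (1 - 2 * p))) bad ∧
      IsClosed E ∧
      arcLengthMeasure E = 0 ∧
      Summable (fun J : ComplementaryArc E => J.length ^ (1 - p / (1 - p))) ∧
      μ = endpointMeasure E ((1 - 2 * p) / (1 - p)) ∧
      IsFiniteMeasure μ ∧
      μ Eᶜ = 0 ∧
      ¬ MemHardy p (deriv (singularInner μ)) := by
  have hp2 : 1 - p ≠ 0 := by linarith
  have hA := two_lt_two_rpow_ratio hp₀ hp₁
  have hs := inv_two_rpow_ratio_rpow hp₁
  have hs0 : 0 < (1 - 2 * p) / (1 - p) := div_pos (by linarith) (by linarith)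
  have hps : (1 - 2 * p) / (1 - p) * (1 - p) = 1 - 2 * p := div_mul_cancel₀ _ hp2
  have hexponent : 1 - p / (1 - p) = (1 - 2 * p) / (1 - p) := by
    field_simp
    ring
  obtain ⟨bad, hsum, hlong⟩ := exists_bad_summable_cantorWeight hA hp₀
  have hlength := summable_length_rpow hA hs0 hs hsum
  have hfinite := isFiniteMeasure_endpointMeasure hlength
  refine ⟨bad, _, _, rfl, isClosed_prunedCantorSet, arcLengthMeasure_prunedCantorSet hA,
    by rwa [hexponent], rfl, hfinite, endpointMeasure_compl isClosed_prunedCantorSet, fun hf => ?_⟩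
  obtain ⟨C, hC⟩ := hf.exists_cantorWeight_mul_rpow_le hp₀ hA hs0 hps hs
  obtain ⟨n, l, hgood, hlt⟩ := hlong C
  exact (hC n l hgood).not_gt hlt
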